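/- Let $\mathcal{T}$ be either the category $\mathbf{Top}$ of non-empty topological spaces and continuous maps (with free homotopies), or the category $\mathbf{Top^w}$ of well-pointed topological spaces (the inclusion of the base point is a closed cofibration) and base point preserving continuous maps (with pointed homotopies). Write $\simeq$ for homotopy of maps in $\mathcal{T}$. A square formed by maps $q\colon P\to X$, $p\colon P\to A$, $f\colon X\to Y$, $\iota\colon A\to Y$ is a homotopy pullback if there is a homotopy $H$ from $f\circ q$ to $\iota\circ p$ for which the induced map $z\mapsto (q(z),H(z,-),p(z))$ from $P$ to the double mapping track $\{(x,\gamma,a)\in X\times Y^{[0,1]}\times A : \gamma(0)=f(x),\ \gamma(1)=\iota(a)\}$ is a homotopy equivalence (a pointed one in $\mathbf{Top^w}$). Let $\mathrm{secat}$ assign to each map $\iota\colon A\to Y$ in $\mathcal{T}$ an element of $\mathbb{N}\cup\{\infty\}$ so that the following axioms hold. (S0) $\mathrm{secat}(\iota)=0$ if and only if $\iota$ has a homotopy section, i.e. there is a map $s\colon Y\to A$ with $\iota\circ s\simeq \mathrm{id}_Y$. (S1) If $\kappa\colon B\to X$, $\iota\colon A\to X$, $\zeta\colon B\to A$ satisfy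 $\kappa\simeq\iota\circ\zeta$, then $\mathrm{secat}(\iota)\le\mathrm{secat}(\kappa)$. (S2) If $q\colon P\to X$, $p\colon P\to A$, $f\colon X\to Y$, $\iota\colon A\to Y$ form a homotopy pullback, then $\mathrm{secat}(q)\le\mathrm{secat}(\iota)$. For $f\colon X\to Y$ and $\iota\colon A\to Y$ let $\mathrm{liftcat}_f(\iota)=\mathrm{secat}(q)$, where $q\colon P\to X$ is the map opposite to $\iota$ in any homotopy pullback of $f$ and $\iota$; by (S1) this does not depend on the choice of the homotopy pullback. Let $\kappa\colon B\to X$, $\zeta\colon B\to A$, $f\colon X\to Y$, $\iota\colon A\to Y$ be maps in $\mathcal{T}$ with $f\circ\kappa\simeq\iota\circ\zeta$. Then: (1) $\mathrm{liftcat}_f(\iota)\le\min\{\mathrm{secat}(\kappa),\mathrm{secat}(\iota)\}$. (2) If the square is a homotopy pullback, then $\mathrm{liftcat}_f(\iota)=\mathrm{secat}(\kappa)\le\mathrm{secat}(\iota)$. (3) If $f$ has a homotopy section, then $\mathrm{liftcat}_f(\iota)=\mathrm{secat}(\iota)\le\mathrm{secat}(\kappa)$. (4) If $f$ and $\zeta$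 are homotopy equivalences, then $\mathrm{liftcat}_f(\iota)=\mathrm{secat}(\kappa)=\mathrm{secat}(\iota)$. -/

import Mathlib

open scoped unitInterval

universe u

namespace LiftCat

/-- `S ⊆ X` is a cofibration: it has the homotopy extension property. -/
def IsCofibration {X : Type u} [TopologicalSpace X] (S : Set X) : Prop :=
  ∀ (Z : Type u) [TopologicalSpace Z] (f : C(X, Z)) (H : C(S × I, Z)),
    (∀ s : S, H (s, 0) = f s) →
      ∃ F : C(X × I, Z), (∀ x, F (x, 0) = f x) ∧ ∀ (s : S) (t : I), F (s, t) = H (s, t)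

/-- The two categories in which one works: `Top`, the category of nonempty topological spaces and
continuous maps, and `Topw`, the category of well-pointed topological spaces and continuous maps
preserving base points. -/
inductive Setting
  | Top
  | Topw

/-- In `Top` there is no base point, which is encoded by the empty set of base points. In `Topw`
there is exactly one base point, and its inclusion is a closed cofibration. -/
def Setting.IsBase {X : Type u} [TopologicalSpace X] : Setting → Set X → Prop
  | .Top, S => S = ∅
  | .Topw, S => ∃ x : X, S = {x} ∧ IsClosed ({x} : Set X) ∧ IsCofibration ({x} : Set X)

/-- The objects of `𝒯`. -/
structure Space (𝒯 : Setting) where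
  carrier : Type u
  [topology : TopologicalSpace carrier]
  [nonempty : Nonempty carrier]
  base : Set carrier
  isBase : 𝒯.IsBase base

instance {𝒯 : Setting} : CoeSort (Space.{u} 𝒯) (Type u) := ⟨Space.carrier⟩

instance {𝒯 : Setting} (X : Space.{u} 𝒯) : TopologicalSpace X := X.topology

instance {𝒯 : Setting} (X : Space.{u} 𝒯) : Nonempty X := X.nonempty

/-- The morphisms of `𝒯`: continuous maps, which preserve the base point if there is one. -/
structure Map {𝒯 : Setting} (X Y : Space.{u} 𝒯) where
  toFun : C(X, Y)
  map_base : Set.MapsTo toFun X.base Y.base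

variable {𝒯 : Setting}

/-- The identity map. -/
def Map.id (X : Space.{u} 𝒯) : Map X X := ⟨ContinuousMap.id X, fun _ hx => hx⟩

/-- Composition of maps. -/
def Map.comp {X Y Z : Space.{u} 𝒯} (g : Map Y Z) (f : Map X Y) : Map X Z :=
  ⟨g.toFun.comp f.toFun, fun _ hx => g.map_base (f.map_base hx)⟩

/-- Homotopy of maps in `𝒯`: free homotopy in `Top` (the set `X.base` is empty), pointed homotopy
in `Topw`. -/
def Homotopic {X Y : Space.{u} 𝒯} (f g : Map X Y) : Prop :=
  f.toFun.HomotopicRel g.toFun X.base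

/-- `f` has a homotopy section. -/
def HasHomotopySection {X Y : Space.{u} 𝒯} (f : Map X Y) : Prop :=
  ∃ s : Map Y X, Homotopic (f.comp s) (Map.id Y)

/-- `w` is a homotopy equivalence, where all maps are required to respect the sets `S` and `T`
of base points, and all homotopies to be stationary on them. For `S = T = ∅` this is a (free)
homotopy equivalence, for one-point sets a pointed homotopy equivalence. -/
def IsHomotopyEquivRel {X Y : Type u} [TopologicalSpace X] [TopologicalSpace Y]
    (S : Set X) (T : Set Y) (w : C(X, Y)) : Prop :=
  Set.MapsTo w S T ∧ ∃ v : C(Y, X), Set.MapsTo v T S ∧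
    (v.comp w).HomotopicRel (ContinuousMap.id X) S ∧
    (w.comp v).HomotopicRel (ContinuousMap.id Y) T

/-- `f` is a homotopy equivalence in `𝒯`. -/
def IsHomotopyEquiv {X Y : Space.{u} 𝒯} (f : Map X Y) : Prop :=
  ∃ g : Map Y X, Homotopic (g.comp f) (Map.id X) ∧ Homotopic (f.comp g) (Map.id Y)

/-- The double mapping track of `f : X → Y` and `ι : A → Y`: the space of triples `(x, γ, a)`
where `γ` is a path in `Y` from `f x` to `ι a`. -/
abbrev Track {X A Y : Space.{u} 𝒯} (f : Map X Y) (ι : Map A Y) : Type u :=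
  {z : X × C(I, Y) × A // z.2.1 0 = f.toFun z.1 ∧ z.2.1 1 = ι.toFun z.2.2}

/-- The base point of the double mapping track in `Topw` is `(x₀, constant path at y₀, a₀)`;
in `Top` this set is empty. -/
def trackBase {X A Y : Space.{u} 𝒯} (f : Map X Y) (ι : Map A Y) : Set (Track f ι) :=
  {z | z.1.1 ∈ X.base ∧ (∀ t, z.1.2.1 t ∈ Y.base) ∧ z.1.2.2 ∈ A.base}

/-- The map `P → Track f ι`, `z ↦ (q z, H(-, z), p z)`, induced by a homotopy `H` from `f ∘ q`
to `ι ∘ p`. -/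
def whisker {P X A Y : Space.{u} 𝒯} {q : Map P X} {p : Map P A} {f : Map X Y} {ι : Map A Y}
    (H : (f.comp q).toFun.HomotopyRel (ι.comp p).toFun P.base) : C(P, Track f ι) where
  toFun z := ⟨(q.toFun z, ⟨fun t => H (t, z), by fun_prop⟩, p.toFun z),
    H.apply_zero z, H.apply_one z⟩
  continuous_toFun := by
    refine Continuous.subtype_mk (Continuous.prodMk (by fun_prop)
      (Continuous.prodMk ?_ (by fun_prop))) _
    exact ContinuousMap.continuous_of_continuous_uncurry _
      (H.continuous.comp (continuous_snd.prodMk continuous_fst))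

/-- The square
```
  P --p--> A
  |q       |ι
  v        v
  X --f--> Y
```
is a homotopy pullback: for some homotopy from `f ∘ q` to `ι ∘ p` (so the square is homotopy
commutative), the induced map from `P` to the double mapping track is a homotopy equivalence. -/
def IsHomotopyPullback {P X A Y : Space.{u} 𝒯}
    (q : Map P X) (p : Map P A) (f : Map X Y) (ι : Map A Y) : Prop :=
  ∃ H : (f.comp q).toFun.HomotopyRel (ι.comp p).toFun P.base,
    IsHomotopyEquivRel P.base (trackBase f ι) (whisker H)

/-- The axioms of an (abstract) sectional category. -/
structure IsSecat (secat : ∀ {A Y : Space.{u} 𝒯}, Map A Y → ℕ∞) : Prop where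
  S0 : ∀ {A Y : Space.{u} 𝒯} (ι : Map A Y), secat ι = 0 ↔ HasHomotopySection ι
  S1 : ∀ {A B X : Space.{u} 𝒯} (ζ : Map B A) (κ : Map B X) (ι : Map A X),
    Homotopic κ (ι.comp ζ) → secat ι ≤ secat κ
  S2 : ∀ {P X A Y : Space.{u} 𝒯} (q : Map P X) (p : Map P A) (f : Map X Y) (ι : Map A Y),
    IsHomotopyPullback q p f ι → secat q ≤ secat ι

/-- The lifting category from `f` to `ι`: the value `secat q` for a homotopy pullback
`(P, q, p)` of `f` and `ι`. All homotopy pullbacks give the same value (see `liftcat_eq`), so the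
infimum over them is that value. -/
noncomputable def liftcat (secat : ∀ {A Y : Space.{u} 𝒯}, Map A Y → ℕ∞)
    {X A Y : Space.{u} 𝒯} (f : Map X Y) (ι : Map A Y) : ℕ∞ :=
  sInf {n | ∃ (P : Space.{u} 𝒯) (q : Map P X) (p : Map P A),
    IsHomotopyPullback q p f ι ∧ n = secat q}

/-- The sectional category does not depend on the choice of the homotopy pullback. -/
theorem secat_le_of_isHomotopyPullback {secat : ∀ {A Y : Space.{u} 𝒯}, Map A Y → ℕ∞}
    (hs : IsSecat secat) {P P' X A Y : Space.{u} 𝒯} {f : Map X Y} {ι : Map A Y}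
    {q : Map P X} {p : Map P A} {q' : Map P' X} {p' : Map P' A}
    (h : IsHomotopyPullback q p f ι) (h' : IsHomotopyPullback q' p' f ι) :
    secat q ≤ secat q' := by
  obtain ⟨H, -, v, hv, -, hwv⟩ := h
  obtain ⟨H', hw', -⟩ := h'
  refine hs.S1 ⟨v.comp (whisker H'), hv.comp hw'⟩ q' q ?_
  obtain ⟨G⟩ := hwv
  let pr : C(Track f ι, X) := ⟨fun z => z.1.1, by fun_prop⟩
  refine ContinuousMap.HomotopicRel.symm ⟨⟨⟨⟨fun z => pr (G (z.1, whisker H' z.2)), by fun_prop⟩,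
    fun x => ?_, fun x => ?_⟩, fun t x hx => ?_⟩⟩
  · exact congrArg pr (G.apply_zero (whisker H' x))
  · exact congrArg pr (G.apply_one (whisker H' x))
  · have := G.eq_fst t (hw' hx)
    simp only [ContinuousMap.coe_mk]
    rw [this]
    rfl

theorem liftcat_eq {secat : ∀ {A Y : Space.{u} 𝒯}, Map A Y → ℕ∞}
    (hs : IsSecat secat) {P X A Y : Space.{u} 𝒯} {f : Map X Y} {ι : Map A Y}
    {q : Map P X} {p : Map P A} (h : IsHomotopyPullback q p f ι) :
    liftcat secat f ι = secat q := by
  refine le_antisymm (sInf_le ⟨P, q, p, h, rfl⟩) (le_sInf ?_)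
  rintro n ⟨P', q', p', h', rfl⟩
  exact secat_le_of_isHomotopyPullback hs h h'

end LiftCat

namespace LiftCat

/-! Everything reduces to one model, the double mapping track with its projections `q` to `X` and
`p` to `A`. Once it is an object of the category, it is a homotopy pullback, and `liftcat_eq` turns
`liftcat` into `secat q`. It is nonempty because the given commuting square maps into it. The four
claims then follow from (S1) and (S2). Since `κ` factors through `q`, `secat q ≤ secat κ`; (S2)
gives `secat q ≤ secat ι`. A homotopy section of `f` gives the reverse of the second inequality, and
inverses of `f` and `ζ` give the reverse of the first. The topological work is the pointed case: the
track must be well-pointed. Cofibrations are replaced by Strøm data (`nonempty_of_isCofibration`,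
`isCofibration`), and such data on `X`, `A`, `Y` are assembled into data on the track
(`trackStrom`). -/

/-! ### Well-pointedness in terms of Strøm structures -/

/-- A Strøm structure on a pointed space `(X, x₀)`: a function `u ≥ 0` vanishing at `x₀` and a
deformation `h` rel `x₀` of the identity which reaches `x₀` at time `u x`, if `u x ≤ 1`. -/
structure StromStructure {X : Type u} [TopologicalSpace X] (x₀ : X) where
  u : X → ℝ
  continuous_u : Continuous u
  u_nonneg : ∀ x, 0 ≤ u x
  u_base : u x₀ = 0
  h : X → I → X
  continuous_h : Continuous fun z : X × I => h z.1 z.2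
  h_zero : ∀ x, h x 0 = x
  h_base : ∀ t, h x₀ t = x₀
  h_eq : ∀ x (t : I), u x ≤ t → h x t = x₀

namespace StromStructure

variable {X : Type u} [TopologicalSpace X] {x₀ : X}

theorem eq_of_u_eq_zero (α : StromStructure x₀) {x : X} (hx : α.u x = 0) : x = x₀ := by
  rw [← α.h_zero x]
  exact α.h_eq x 0 (by simp [hx])

theorem isClosed (α : StromStructure x₀) : IsClosed ({x₀} : Set X) := by
  have : ({x₀} : Set X) = α.u ⁻¹' {0} := by
    ext x
    exact ⟨fun hx => by rw [Set.mem_singleton_iff.1 hx]; exact α.u_base, α.eq_of_u_eq_zero⟩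
  rw [this]
  exact isClosed_singleton.preimage α.continuous_u

/-- Follow `f` along the deformation until time `u x`, when `x₀` is reached, then run the given
homotopy at `x₀` with the remaining time. -/
theorem isCofibration (α : StromStructure x₀) : IsCofibration ({x₀} : Set X) := by
  intro Z _ f H hH
  let b : ({x₀} : Set X) := ⟨x₀, rfl⟩
  have hu := α.continuous_u
  have hh := α.continuous_h
  refine ⟨⟨fun z => if (z.2 : ℝ) ≤ α.u z.1 then f (α.h z.1 z.2)
    else H (b, Set.projIcc 0 1 zero_le_one ((z.2 : ℝ) - α.u z.1)), ?_⟩, fun x => ?_, ?_⟩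
  · refine Continuous.if_le (by fun_prop)
      (H.continuous.comp (continuous_const.prodMk (continuous_projIcc.comp (by fun_prop))))
      (by fun_prop) (by fun_prop) fun z hz => ?_
    rw [α.h_eq _ _ hz.ge, hz, sub_self, Set.projIcc_left]
    exact (hH b).symm
  · simp [α.u_nonneg, α.h_zero]
  · rintro ⟨s, rfl⟩ t
    simp only [ContinuousMap.coe_mk, α.u_base, α.h_base, sub_zero, Set.projIcc_val]
    split_ifs with ht
    · obtain rfl : t = 0 := le_antisymm ht t.2.1
      exact (hH b).symm
    · rfl

/-- A closed base point whose inclusion is a cofibration has a Strøm structure. -/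
theorem nonempty_of_isCofibration (hc : IsClosed ({x₀} : Set X))
    (hX : IsCofibration ({x₀} : Set X)) : Nonempty (StromStructure x₀) := by
  -- Extending the inclusions gives a retraction `r` of the cylinder onto `X × 0 ∪ x₀ × I`; `d x`
  -- measures how far it changes the time coordinate.
  obtain ⟨r, hr0, hr⟩ := hX {z : X × I // z.2 = 0 ∨ z.1 = x₀}
    ⟨fun x => ⟨(x, 0), Or.inl rfl⟩, by fun_prop⟩
    ⟨fun z => ⟨(x₀, z.2), Or.inr rfl⟩, by fun_prop⟩ (by rintro ⟨s, rfl⟩; rfl)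
  let d : C(X, C(I, ℝ)) :=
    ContinuousMap.curry ⟨fun z => (z.2 : ℝ) - ((r z).1.2 : ℝ), by fun_prop⟩
  have hd : ∀ x (t : I), |(t : ℝ) - ((r (x, t)).1.2 : ℝ)| ≤ ‖d x‖ := fun x t => (d x).norm_coe_le_norm t
  have hbase : ∀ t, r (x₀, t) = ⟨(x₀, t), Or.inr rfl⟩ := fun t => hr ⟨x₀, rfl⟩ t
  have hpos : ∀ x (t : I), ‖d x‖ < t → (r (x, t)).1.1 = x₀ := fun x t ht => by
    refine (r (x, t)).2.resolve_left fun h0 => ?_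
    have := hd x t
    rw [h0] at this
    simp only [Set.Icc.coe_zero, sub_zero] at this
    exact absurd ((le_abs_self _).trans this) (not_le.2 ht)
  -- `hpos` needs the strict bound `‖d x‖ < t`; the factor 2 derives it from `u x ≤ t` when `‖d x‖ >
  -- 0`.
  refine ⟨⟨fun x => 2 * ‖d x‖, by fun_prop, fun x => by positivity, ?_,
    fun x t => (r (x, t)).1.1, continuous_fst.comp (continuous_subtype_val.comp r.continuous),
    fun x => by simp [hr0], fun t => by simp [hbase], ?_⟩⟩
  · have : d x₀ = 0 := by
      ext t
      simp [d, hbase]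
    simp [this]
  · intro x t ht
    rcases (norm_nonneg (d x)).eq_or_lt with h0 | h0
    -- If `‖d x‖ = 0`, the deformation is at `x₀` for all `t > 0`, hence also at `t = 0` because the
    -- base point is closed.
    · have hx : x = x₀ := by
        have hcl : IsClosed {t : I | (r (x, t)).1.1 = x₀} :=
          hc.preimage (f := fun t : I => (r (x, t)).1.1) (by fun_prop)
        have hsub : Set.Ioi (0 : I) ⊆ {t : I | (r (x, t)).1.1 = x₀} := fun t ht =>
          hpos x t (by rw [← h0]; exact ht)
        have h0mem : (0 : I) ∈ closure (Set.Ioi (0 : I)) := by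
          rw [closure_Ioi' ⟨1, zero_lt_one⟩]
          exact Set.self_mem_Ici
        have := hcl.closure_subset_iff.2 hsub h0mem
        simpa [hr0] using this
      rw [hx, hbase]
    · exact hpos x t (by linarith)

end StromStructure

theorem Space.eq_of_mem_base {𝒯 : Setting} (X : Space.{u} 𝒯) {x y : X} (hx : x ∈ X.base)
    (hy : y ∈ X.base) : x = y := by
  cases 𝒯 with
  | Top =>
    rw [show X.base = ∅ from X.isBase] at hx
    exact hx.elim
  | Topw =>
    obtain ⟨x₀, h, -⟩ := X.isBase
    rw [h] at hx hy
    exact hx.trans hy.symm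

/-! ### Deformation of the double mapping track to its base point -/

section Track

variable {𝒯 : Setting} {X A Y : Space.{u} 𝒯} {f : Map X Y} {ι : Map A Y}

section Deformation

variable {x₀ : X} {a₀ : A} {y₀ : Y} (α : StromStructure x₀) (β : StromStructure a₀)

/-- The path of `z : Track f ι`, prolonged at both ends along the images of the deformations of its
end points. -/
noncomputable def prolong (z : Track f ι) (w : ℝ) : Y :=
  if w ≤ 0 then f.toFun (α.h z.1.1 (Set.projIcc 0 1 zero_le_one (-w)))
  else if w ≤ 1 then z.1.2.1 (Set.projIcc 0 1 zero_le_one w)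
  else ι.toFun (β.h z.1.2.2 (Set.projIcc 0 1 zero_le_one (w - 1)))

theorem continuous_prolong : Continuous fun z : Track f ι × ℝ => prolong α β z.1 z.2 := by
  have hα := α.continuous_h
  have hβ := β.continuous_h
  have hp : Continuous (Set.projIcc (0 : ℝ) 1 zero_le_one) := continuous_projIcc
  refine Continuous.if_le
    (f.toFun.continuous.comp (hα.comp (Continuous.prodMk (by fun_prop) (hp.comp (by fun_prop)))))
    (Continuous.if_le
      (continuous_eval.comp (Continuous.prodMk (by fun_prop) (hp.comp (by fun_prop))))
      (ι.toFun.continuous.comp (hβ.comp (Continuous.prodMk (by fun_prop) (hp.comp (by fun_prop)))))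
      (by fun_prop) (by fun_prop) ?_) (by fun_prop) (by fun_prop) ?_
  · rintro ⟨z, w⟩ (rfl : w = 1)
    simp [β.h_zero, z.2.2]
  · rintro ⟨z, w⟩ (rfl : w = 0)
    simp [α.h_zero, z.2.1]

theorem prolong_neg (z : Track f ι) (t : I) : prolong α β z (-t) = f.toFun (α.h z.1.1 t) := by
  rw [prolong, if_pos (neg_nonpos.2 t.2.1), neg_neg, Set.projIcc_val]

theorem prolong_coe (z : Track f ι) (t : I) : prolong α β z t = z.1.2.1 t := by
  by_cases h : (t : ℝ) ≤ 0
  · obtain rfl : t = 0 := le_antisymm h t.2.1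
    simp [prolong, α.h_zero, z.2.1]
  · rw [prolong, if_neg h, if_pos t.2.2, Set.projIcc_val]

theorem prolong_one_add (z : Track f ι) (t : I) :
    prolong α β z (1 + t) = ι.toFun (β.h z.1.2.2 t) := by
  have h0 : ¬ (1 + (t : ℝ)) ≤ 0 := by linarith [t.2.1]
  by_cases h : (1 + (t : ℝ)) ≤ 1
  · obtain rfl : t = 0 := le_antisymm (by linarith : (t : ℝ) ≤ 0) t.2.1
    simp [prolong, β.h_zero, z.2.2]
  · rw [prolong, if_neg h0, if_neg h, add_sub_cancel_left, Set.projIcc_val]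

theorem prolong_base (hf : f.toFun x₀ = y₀) (hι : ι.toFun a₀ = y₀) {z : Track f ι}
    (hx : z.1.1 = x₀) (hγ : ∀ t, z.1.2.1 t = y₀) (ha : z.1.2.2 = a₀) (w : ℝ) :
    prolong α β z w = y₀ := by
  unfold prolong
  split_ifs
  · rw [hx, α.h_base, hf]
  · exact hγ _
  · rw [ha, β.h_base, hι]

/-- The time at which both end points of `z` have been deformed to the base points. -/
noncomputable def endTime (z : Track f ι) : ℝ := max (α.u z.1.1) (β.u z.1.2.2)

theorem continuous_endTime : Continuous (endTime α β : Track f ι → ℝ) := by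
  have hα := α.continuous_u
  have hβ := β.continuous_u
  unfold endTime
  fun_prop

theorem endTime_nonneg (z : Track f ι) : 0 ≤ endTime α β z :=
  (α.u_nonneg _).trans (le_max_left _ _)

/-- The time `t`, stopped at `endTime`. -/
noncomputable def stoppedTime (z : Track f ι) (t : I) : I :=
  Set.projIcc 0 1 zero_le_one (min t (endTime α β z))

theorem coe_stoppedTime (z : Track f ι) (t : I) :
    (stoppedTime α β z t : ℝ) = min (t : ℝ) (endTime α β z) := by
  unfold stoppedTime
  rw [Set.projIcc_of_mem _ ⟨le_min t.2.1 (endTime_nonneg α β z), (min_le_left _ _).trans t.2.2⟩]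

theorem stoppedTime_zero (z : Track f ι) : stoppedTime α β z 0 = 0 := by
  apply Subtype.ext
  rw [coe_stoppedTime]
  simpa using endTime_nonneg α β z

theorem continuous_stoppedTime :
    Continuous fun z : Track f ι × I => stoppedTime α β z.1 z.2 := by
  have := continuous_endTime (f := f) (ι := ι) α β
  exact continuous_projIcc.comp (by fun_prop)

/-- The first stage of the deformation of the path of `z`, at time `t`: its prolongation to
`[-t, 1 + t]`, reparametrized. -/
noncomputable def stretch (z : Track f ι) (t : I) (s : I) : Y :=
  prolong α β z ((s : ℝ) * (1 + 2 * t) - t)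

theorem continuous_stretch :
    Continuous fun z : Track f ι × I × I => stretch α β z.1 z.2.1 z.2.2 :=
  (continuous_prolong α β).comp (Continuous.prodMk (by fun_prop) (by fun_prop))

theorem stretch_time_zero (z : Track f ι) (s : I) : stretch α β z 0 s = z.1.2.1 s := by
  rw [← prolong_coe α β z s, stretch]
  simp

theorem stretch_left (z : Track f ι) (t : I) : stretch α β z t 0 = f.toFun (α.h z.1.1 t) := by
  rw [← prolong_neg α β z t, stretch]
  simp

theorem stretch_right (z : Track f ι) (t : I) :
    stretch α β z t 1 = ι.toFun (β.h z.1.2.2 t) := by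
  rw [← prolong_one_add α β z t, stretch]
  congr 1
  simp only [Set.Icc.coe_one]
  ring

variable (θ : StromStructure y₀)

/-- The time of the second stage of the deformation. -/
noncomputable def lateTime (z : Track f ι) (t : I) : I :=
  Set.projIcc 0 1 zero_le_one ((t : ℝ) - endTime α β z)

theorem continuous_lateTime : Continuous fun z : Track f ι × I => lateTime α β z.1 z.2 := by
  have := continuous_endTime (f := f) (ι := ι) α β
  exact continuous_projIcc.comp (by fun_prop)

theorem lateTime_of_le {z : Track f ι} {t : I} (h : (t : ℝ) ≤ endTime α β z) :
    lateTime α β z t = 0 :=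
  Set.projIcc_of_le_left _ (sub_nonpos.2 h)

theorem coe_lateTime_of_le {z : Track f ι} {t : I} (h : endTime α β z ≤ t) :
    (lateTime α β z t : ℝ) = (t : ℝ) - endTime α β z := by
  unfold lateTime
  rw [Set.projIcc_of_mem _ ⟨sub_nonneg.2 h, by linarith [t.2.2, endTime_nonneg α β z]⟩]

theorem h_fst_stoppedTime_of_le {z : Track f ι} {t : I} (h : endTime α β z ≤ t) :
    α.h z.1.1 (stoppedTime α β z t) = x₀ :=
  α.h_eq _ _ (by rw [coe_stoppedTime, min_eq_right h]; exact le_max_left _ _)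

theorem h_snd_stoppedTime_of_le {z : Track f ι} {t : I} (h : endTime α β z ≤ t) :
    β.h z.1.2.2 (stoppedTime α β z t) = a₀ :=
  β.h_eq _ _ (by rw [coe_stoppedTime, min_eq_right h]; exact le_max_right _ _)

/-- The path of the deformation of `z` at time `t`. -/
noncomputable def deformPath (z : Track f ι) (t : I) (s : I) : Y :=
  θ.h (stretch α β z (stoppedTime α β z t) s) (lateTime α β z t)

theorem continuous_deformPath :
    Continuous fun z : (Track f ι × I) × I => deformPath α β θ z.1.1 z.1.2 z.2 := by
  have h1 := continuous_stretch (f := f) (ι := ι) α β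
  have h2 := continuous_stoppedTime (f := f) (ι := ι) α β
  have h3 := continuous_lateTime (f := f) (ι := ι) α β
  exact θ.continuous_h.comp (Continuous.prodMk
    (h1.comp (Continuous.prodMk (by fun_prop)
      (Continuous.prodMk (h2.comp continuous_fst) (by fun_prop)))) (h3.comp continuous_fst))

/-- Up to `endTime` the second stage has not begun; afterwards this end lies at `y₀`, which `θ`
fixes. So the path always keeps its required end point. -/
theorem deformPath_left (hf : f.toFun x₀ = y₀) (z : Track f ι) (t : I) :
    deformPath α β θ z t 0 = f.toFun (α.h z.1.1 (stoppedTime α β z t)) := by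
  rw [deformPath, stretch_left]
  rcases le_total (t : ℝ) (endTime α β z) with h | h
  · rw [lateTime_of_le α β h, θ.h_zero]
  · rw [h_fst_stoppedTime_of_le α β h, hf, θ.h_base]

theorem deformPath_right (hι : ι.toFun a₀ = y₀) (z : Track f ι) (t : I) :
    deformPath α β θ z t 1 = ι.toFun (β.h z.1.2.2 (stoppedTime α β z t)) := by
  rw [deformPath, stretch_right]
  rcases le_total (t : ℝ) (endTime α β z) with h | h
  · rw [lateTime_of_le α β h, θ.h_zero]
  · rw [h_snd_stoppedTime_of_le α β h, hι, θ.h_base]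

/-- The distance of the path of `z` from the base point at the end of the first stage. -/
noncomputable def pathHeight (z : Track f ι) : C(I, ℝ) :=
  ⟨fun s => θ.u (stretch α β z (stoppedTime α β z 1) s), by
    have h1 := continuous_stretch (f := f) (ι := ι) α β
    have h2 := θ.continuous_u
    exact h2.comp (h1.comp (by fun_prop :
      Continuous fun s : I => (z, stoppedTime α β z 1, s)))⟩

theorem continuous_pathHeight :
    Continuous (pathHeight α β θ : Track f ι → C(I, ℝ)) := by
  have h1 := continuous_stretch (f := f) (ι := ι) α β
  have h2 := continuous_stoppedTime (f := f) (ι := ι) α β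
  refine ContinuousMap.continuous_of_continuous_uncurry _ (θ.continuous_u.comp (h1.comp
    (Continuous.prodMk continuous_fst (Continuous.prodMk ?_ continuous_snd))))
  exact h2.comp (continuous_fst.prodMk continuous_const)

/-- The double mapping track of pointed maps between spaces with Strøm structures has a Strøm
structure. -/
noncomputable def trackStrom (hf : f.toFun x₀ = y₀) (hι : ι.toFun a₀ = y₀) (z₀ : Track f ι)
    (hx : z₀.1.1 = x₀) (hγ : ∀ t, z₀.1.2.1 t = y₀) (ha : z₀.1.2.2 = a₀) : StromStructure z₀ where
  -- The two terms bound the two stages: bringing both ends to the base points, then contracting the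
  -- resulting loop by `θ`, uniformly along the path.
  u z := endTime α β z + ‖pathHeight α β θ z‖
  continuous_u := (continuous_endTime α β).add (continuous_pathHeight α β θ).norm
  u_nonneg z := add_nonneg (endTime_nonneg α β z) (norm_nonneg _)
  u_base := by
    have h1 : endTime α β z₀ = 0 := by simp [endTime, hx, ha, α.u_base, β.u_base]
    have h2 : pathHeight α β θ z₀ = 0 := by
      ext s
      simp [pathHeight, stretch, prolong_base α β hf hι hx hγ ha, θ.u_base]
    rw [h1, h2, norm_zero, add_zero]
  h z t := ⟨(α.h z.1.1 (stoppedTime α β z t), ⟨deformPath α β θ z t,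
      (continuous_deformPath α β θ).comp (by fun_prop : Continuous fun s : I => ((z, t), s))⟩,
      β.h z.1.2.2 (stoppedTime α β z t)),
    deformPath_left α β θ hf z t, deformPath_right α β θ hι z t⟩
  continuous_h := by
    have h2 := continuous_stoppedTime (f := f) (ι := ι) α β
    refine Continuous.subtype_mk (Continuous.prodMk ?_ (Continuous.prodMk ?_ ?_)) _
    · exact α.continuous_h.comp (Continuous.prodMk (by fun_prop) h2)
    · exact ContinuousMap.continuous_of_continuous_uncurry _ (continuous_deformPath α β θ)
    · exact β.continuous_h.comp (Continuous.prodMk (by fun_prop) h2)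
  h_zero z := by
    refine Subtype.ext (Prod.ext ?_ (Prod.ext (ContinuousMap.ext fun s => ?_) ?_))
    · simp [stoppedTime_zero, α.h_zero]
    · have : lateTime α β z 0 = 0 := lateTime_of_le α β (endTime_nonneg α β z)
      simp [deformPath, stoppedTime_zero, stretch_time_zero, this, θ.h_zero]
    · simp [stoppedTime_zero, β.h_zero]
  h_base t := by
    refine Subtype.ext (Prod.ext ?_ (Prod.ext (ContinuousMap.ext fun s => ?_) ?_))
    · simp [hx, α.h_base]
    · simp [deformPath, stretch, prolong_base α β hf hι hx hγ ha, hγ, θ.h_base]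
    · simp [ha, β.h_base]
  h_eq z t ht := by
    have hle : endTime α β z ≤ t := le_trans (le_add_of_nonneg_right (norm_nonneg _)) ht
    refine Subtype.ext (Prod.ext ?_ (Prod.ext (ContinuousMap.ext fun s => ?_) ?_))
    · exact (h_fst_stoppedTime_of_le α β hle).trans hx.symm
    -- After `endTime` the stretching is frozen, so the height recorded at time 1 is that of the
    -- current path.
    · have hst : stoppedTime α β z t = stoppedTime α β z 1 := by
        apply Subtype.ext
        rw [coe_stoppedTime, coe_stoppedTime, min_eq_right hle, Set.Icc.coe_one,
          min_eq_right (hle.trans t.2.2)]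
      refine Eq.trans (θ.h_eq _ _ ?_) (hγ s).symm
      rw [coe_lateTime_of_le α β hle, hst]
      have : θ.u (stretch α β z (stoppedTime α β z 1) s) ≤ ‖pathHeight α β θ z‖ :=
        (le_abs_self _).trans ((pathHeight α β θ z).norm_coe_le_norm s)
      linarith
    · exact (h_snd_stoppedTime_of_le α β hle).trans ha.symm

end Deformation

/-! ### The track as a homotopy pullback in the category -/

theorem isBase_trackBase : 𝒯.IsBase (trackBase f ι) := by
  cases 𝒯 with
  | Top =>
    have hX : X.base = ∅ := X.isBase
    exact Set.eq_empty_of_forall_notMem fun z hz => by simpa [hX] using hz.1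
  | Topw =>
    obtain ⟨x₀, hx, hxc, hxs⟩ := X.isBase
    obtain ⟨a₀, ha, hac, has⟩ := A.isBase
    obtain ⟨y₀, hy, hyc, hys⟩ := Y.isBase
    obtain ⟨α⟩ := StromStructure.nonempty_of_isCofibration hxc hxs
    obtain ⟨β⟩ := StromStructure.nonempty_of_isCofibration hac has
    obtain ⟨θ⟩ := StromStructure.nonempty_of_isCofibration hyc hys
    have hf : f.toFun x₀ = y₀ := by
      have := f.map_base (hx ▸ Set.mem_singleton x₀)
      rwa [hy] at this
    have hι : ι.toFun a₀ = y₀ := by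
      have := ι.map_base (ha ▸ Set.mem_singleton a₀)
      rwa [hy] at this
    let z₀ : Track f ι := ⟨(x₀, ContinuousMap.const I y₀, a₀), hf.symm, hι.symm⟩
    let ω : StromStructure z₀ := trackStrom α β θ hf hι z₀ rfl (fun _ => rfl) rfl
    refine ⟨z₀, ?_, ω.isClosed, ω.isCofibration⟩
    ext z
    simp only [trackBase, hx, ha, hy, Set.mem_ofPred_eq, Set.mem_singleton_iff]
    constructor
    · rintro ⟨h1, h2, h3⟩
      exact Subtype.ext (Prod.ext h1 (Prod.ext (ContinuousMap.ext h2) h3))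
    · rintro rfl
      exact ⟨rfl, fun _ => rfl, rfl⟩

/-- The double mapping track as an object of `𝒯`. -/
def trackSpace (f : Map X Y) (ι : Map A Y) [Nonempty (Track f ι)] : Space.{u} 𝒯 where
  carrier := Track f ι
  base := trackBase f ι
  isBase := isBase_trackBase

/-- The projection of the double mapping track of `f` and `ι` to the source of `f`. -/
def trackFst (f : Map X Y) (ι : Map A Y) [Nonempty (Track f ι)] : Map (trackSpace f ι) X where
  toFun := ⟨fun z : Track f ι => z.1.1, by fun_prop⟩
  map_base _ hz := hz.1

/-- The projection of the double mapping track of `f` and `ι` to the source of `ι`. -/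
def trackSnd (f : Map X Y) (ι : Map A Y) [Nonempty (Track f ι)] : Map (trackSpace f ι) A where
  toFun := ⟨fun z : Track f ι => z.1.2.2, by fun_prop⟩
  map_base _ hz := hz.2.2

/-- Evaluation of paths, a homotopy between the two maps from the double mapping track. -/
def trackHomotopy (f : Map X Y) (ι : Map A Y) [Nonempty (Track f ι)] :
    (f.comp (trackFst f ι)).toFun.HomotopyRel (ι.comp (trackSnd f ι)).toFun
      (trackSpace f ι).base where
  toFun z := (show Track f ι from z.2).1.2.1 z.1
  continuous_toFun := by
    have : Continuous fun z : I × Track f ι => z.2.1.2.1 z.1 := by fun_prop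
    exact this
  map_zero_left z := z.2.1
  map_one_left z := z.2.2
  prop' t z hz := by
    refine Eq.trans ?_ z.2.1
    exact Y.eq_of_mem_base (hz.2.1 t) (hz.2.1 0)

theorem isHomotopyPullback_track [Nonempty (Track f ι)] :
    IsHomotopyPullback (trackFst f ι) (trackSnd f ι) f ι := by
  refine ⟨trackHomotopy f ι, fun z hz => hz, ContinuousMap.id (Track f ι), fun z hz => hz,
    ?_, ?_⟩
  · exact ContinuousMap.HomotopicRel.refl (ContinuousMap.id (Track f ι))
  · exact ContinuousMap.HomotopicRel.refl (ContinuousMap.id (Track f ι))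

end Track

/-! ### Homotopy calculus and factorization through the track -/

section Maps

variable {𝒯 : Setting} {W X Y Z : Space.{u} 𝒯}

theorem Homotopic.refl (f : Map X Y) : Homotopic f f := ContinuousMap.HomotopicRel.refl _

theorem Homotopic.symm {f g : Map X Y} (h : Homotopic f g) : Homotopic g f :=
  ContinuousMap.HomotopicRel.symm h

theorem Homotopic.trans {f g k : Map X Y} (h : Homotopic f g) (h' : Homotopic g k) :
    Homotopic f k :=
  ContinuousMap.HomotopicRel.trans h h'

theorem Homotopic.comp_left {f g : Map X Y} (k : Map Y Z) (h : Homotopic f g) :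
    Homotopic (k.comp f) (k.comp g) :=
  h.map fun H => H.compContinuousMap k.toFun

theorem Homotopic.comp_right {f g : Map X Y} (h : Homotopic f g) (k : Map W X) :
    Homotopic (f.comp k) (g.comp k) := by
  obtain ⟨H⟩ := h
  refine ⟨⟨⟨⟨fun z => H (z.1, k.toFun z.2), by fun_prop⟩, fun x => ?_, fun x => ?_⟩, ?_⟩⟩
  · exact H.apply_zero _
  · exact H.apply_one _
  · intro t x hx
    exact H.eq_fst t (k.map_base hx)

theorem mapsTo_whisker {P A : Space.{u} 𝒯} {q : Map P X} {p : Map P A} {f : Map X Y} {ι : Map A Y}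
    (H : (f.comp q).toFun.HomotopyRel (ι.comp p).toFun P.base) :
    Set.MapsTo (whisker H) P.base (trackBase f ι) := fun z hz => by
  refine ⟨q.map_base hz, fun t => ?_, p.map_base hz⟩
  have : H (t, z) = (f.comp q).toFun z := H.eq_fst t hz
  change H (t, z) ∈ Y.base
  rw [this]
  exact (f.comp q).map_base hz

theorem nonempty_track_of_homotopic {P A : Space.{u} 𝒯} {q : Map P X} {p : Map P A} {f : Map X Y}
    {ι : Map A Y} (h : Homotopic (f.comp q) (ι.comp p)) : Nonempty (Track f ι) :=
  h.elim fun H => P.nonempty.map (whisker H)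

/-- A homotopy commutative square factors strictly through the double mapping track. -/
theorem exists_trackFst_comp_eq {P A : Space.{u} 𝒯} {q : Map P X} {p : Map P A} {f : Map X Y}
    {ι : Map A Y} [Nonempty (Track f ι)] (h : Homotopic (f.comp q) (ι.comp p)) :
    ∃ w : Map P (trackSpace f ι), (trackFst f ι).comp w = q := by
  obtain ⟨H⟩ := h
  exact ⟨⟨whisker H, mapsTo_whisker H⟩, rfl⟩

theorem trackHomotopic {A : Space.{u} 𝒯} (f : Map X Y) (ι : Map A Y) [Nonempty (Track f ι)] :
    Homotopic (f.comp (trackFst f ι)) (ι.comp (trackSnd f ι)) :=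
  ⟨trackHomotopy f ι⟩

theorem IsHomotopyEquiv.hasHomotopySection {f : Map X Y} (h : IsHomotopyEquiv f) :
    HasHomotopySection f :=
  h.imp fun _ hg => hg.2

end Maps

/-! ### Inequalities from the axioms -/

section Secat

variable {𝒯 : Setting} {secat : ∀ {A Y : Space.{u} 𝒯}, Map A Y → ℕ∞} {A B X Y : Space.{u} 𝒯}
  {κ : Map B X} {ζ : Map B A} {f : Map X Y} {ι : Map A Y}

theorem liftcat_le_secat_left (hs : IsSecat secat)
    (hcomm : Homotopic (f.comp κ) (ι.comp ζ)) : liftcat secat f ι ≤ secat κ := by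
  have := nonempty_track_of_homotopic hcomm
  rw [liftcat_eq hs isHomotopyPullback_track]
  obtain ⟨w, hw⟩ := exists_trackFst_comp_eq hcomm
  exact hs.S1 w _ _ (hw ▸ Homotopic.refl _)

theorem liftcat_le_secat_right (hs : IsSecat secat) [Nonempty (Track f ι)] :
    liftcat secat f ι ≤ secat ι := by
  rw [liftcat_eq hs isHomotopyPullback_track]
  exact hs.S2 _ _ _ _ isHomotopyPullback_track

/-- Pull `q` back along the section `s` to a map `q'`, so `secat q' ≤ secat q`. Since `q' ≃ f s q'`
and `s q'` factors through `q`, the map `q'` factors through `ι`, and (S1) applies. No pasting of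
pullbacks is needed. -/
theorem secat_le_liftcat_of_hasHomotopySection (hs : IsSecat secat) [Nonempty (Track f ι)]
    (hf : HasHomotopySection f) : secat ι ≤ liftcat secat f ι := by
  rw [liftcat_eq hs isHomotopyPullback_track]
  obtain ⟨s, hfs⟩ := hf
  have h1 : Homotopic (f.comp (s.comp ι)) (ι.comp (Map.id A)) := hfs.comp_right ι
  -- The lift `w` of `s ∘ ι` serves only to show that the second track is nonempty.
  obtain ⟨w, hw⟩ := exists_trackFst_comp_eq h1
  have h2 : Homotopic (s.comp ι) ((trackFst f ι).comp w) := hw ▸ Homotopic.refl _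
  have := nonempty_track_of_homotopic h2
  refine le_trans (hs.S1 ((trackSnd f ι).comp (trackSnd s (trackFst f ι)))
    (trackFst s (trackFst f ι)) ι ?_) (hs.S2 _ _ s _ isHomotopyPullback_track)
  have h3 : Homotopic (f.comp (s.comp (trackFst s (trackFst f ι)))) (trackFst s (trackFst f ι)) :=
    hfs.comp_right _
  have h4 := (trackHomotopic s (trackFst f ι)).comp_left f
  exact h3.symm.trans (h4.trans ((trackHomotopic f ι).comp_right _))

/-- With inverses `g` of `f` and `η` of `ζ`, `q ≃ g f q ≃ g ι p ≃ g ι ζ η p ≃ g f κ η p ≃ κ η p`, so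
`q` factors through `κ`. -/
theorem secat_le_liftcat_of_isHomotopyEquiv (hs : IsSecat secat)
    (hcomm : Homotopic (f.comp κ) (ι.comp ζ)) (hf : IsHomotopyEquiv f) (hζ : IsHomotopyEquiv ζ) :
    secat κ ≤ liftcat secat f ι := by
  have := nonempty_track_of_homotopic hcomm
  rw [liftcat_eq hs isHomotopyPullback_track]
  obtain ⟨g, hgf, -⟩ := hf
  obtain ⟨η, -, hη⟩ := hζ
  refine hs.S1 (η.comp (trackSnd f ι)) _ κ ?_
  have h1 : Homotopic (g.comp (f.comp (trackFst f ι))) (trackFst f ι) := hgf.comp_right _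
  have h2 := (trackHomotopic f ι).comp_left g
  have h3 : Homotopic (g.comp (ι.comp ((ζ.comp η).comp (trackSnd f ι))))
      (g.comp (ι.comp (trackSnd f ι))) :=
    ((hη.comp_right (trackSnd f ι)).comp_left ι).comp_left g
  have h4 := (hcomm.comp_right (η.comp (trackSnd f ι))).comp_left g
  have h5 : Homotopic ((g.comp f).comp (κ.comp (η.comp (trackSnd f ι))))
      (κ.comp (η.comp (trackSnd f ι))) := hgf.comp_right _
  exact h1.symm.trans (h2.trans (h3.symm.trans (h4.symm.trans h5)))

end Secat

end LiftCat

open LiftCat in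
theorem mainTheorem5 (𝒯 : Setting)
    (secat : ∀ {A Y : Space.{u} 𝒯}, Map A Y → ℕ∞) (hsecat : IsSecat secat)
    {A B X Y : Space.{u} 𝒯} (κ : Map B X) (ζ : Map B A) (f : Map X Y) (ι : Map A Y)
    (hcomm : Homotopic (f.comp κ) (ι.comp ζ)) :
    liftcat secat f ι ≤ min (secat κ) (secat ι) ∧
    (IsHomotopyPullback κ ζ f ι →
      liftcat secat f ι = secat κ ∧ secat κ ≤ secat ι) ∧
    (HasHomotopySection f →
      liftcat secat f ι = secat ι ∧ secat ι ≤ secat κ) ∧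
    (IsHomotopyEquiv f → IsHomotopyEquiv ζ →
      liftcat secat f ι = secat κ ∧ secat κ = secat ι) := by
  have := nonempty_track_of_homotopic hcomm
  have hκ := liftcat_le_secat_left hsecat hcomm
  have hι := liftcat_le_secat_right hsecat (f := f) (ι := ι)
  have hsec : HasHomotopySection f → liftcat secat f ι = secat ι := fun hf =>
    le_antisymm hι (secat_le_liftcat_of_hasHomotopySection hsecat hf)
  refine ⟨le_min hκ hι, fun h => ⟨liftcat_eq hsecat h, hsecat.S2 _ _ _ _ h⟩,
    fun hf => ⟨hsec hf, hsec hf ▸ hκ⟩, fun hf hζ => ?_⟩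
  have h1 : liftcat secat f ι = secat κ :=
    le_antisymm hκ (secat_le_liftcat_of_isHomotopyEquiv hsecat hcomm hf hζ)
  exact ⟨h1, h1.symm.trans (hsec hf.hasHomotopySection)⟩
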